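/- For a finite-dimensional unital associative $\mathbb{C}$-algebra $A$ with basis $e_1,\dots,e_m$, let $\mathbf{R}(A)$ (the bilinear complexity of $A$) be the tensor rank of its structure tensor $\sum_{i,j} e_i\otimes e_j\otimes (e_i e_j)\in A\otimes A\otimes A$, that is, the least $r$ such that this tensor is a sum of $r$ simple tensors $u\otimes v\otimes w$; it does not depend on the basis. Let $M_N$ be the algebra of complex $N\times N$ matrices and let $\omega=\inf\{c\in\mathbb{R} : \mathbf{R}(M_N)=O(N^c)\}$ be the exponent of matrix multiplication. For a polynomial $f\in\mathbb{C}[x_1,\dots,x_m]$, let $\operatorname{Ann}(f)$ be the ideal of all $h\in\mathbb{C}[\partial_1,\dots,\partial_m]$ with $h(\partial/\partial x_1,\dots,\partial/\partial x_m)f=0$, and let $\mathcal{A}_f=\mathbb{C}[\partial_1,\dots,\partial_m]/\operatorname{Ann}(f)$ be the apolar algebra of $f$. Let $\det_n$ be the determinant of the $n\times n$ matrix of $n^2$ independent variables. Theorem. $\mathbf{R}(\mathcal{A}_{\det_n})\le O(n2^{\omega n})$, where, as usual for the exponent of matrix multiplication, $\omega$ in the bound stands for any $\omega+\varepsilon$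 with $\varepsilon>0$, and for $\omega$ itself if the infimum is attained. Precisely, as $n\to\infty$: 1. for every $\varepsilon>0$, $\mathbf{R}(\mathcal{A}_{\det_n}) = O_\varepsilon\left(n\,2^{(\omega+\varepsilon)n}\right)$; 2. if $\mathbf{R}(M_N)=O(N^{\omega})$, then $\mathbf{R}(\mathcal{A}_{\det_n}) = O\left(n\,2^{\omega n}\right)$; 3. unconditionally, $\mathbf{R}(\mathcal{A}_{\det_n}) = O\left(n\,\mathbf{R}(M_{2^n})\right)$. -/

import Mathlib

open scoped TensorProduct
open Asymptotics Filter

/-! ### Polynomials as constant-coefficient differential operators -/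

/-- Partial derivatives of polynomials commute. -/
theorem pderiv_toLinearMap_comm {σ : Type*} (i j : σ) :
    (MvPolynomial.pderiv (R := ℂ) i).toLinearMap * (MvPolynomial.pderiv (R := ℂ) j).toLinearMap =
      (MvPolynomial.pderiv (R := ℂ) j).toLinearMap *
        (MvPolynomial.pderiv (R := ℂ) i).toLinearMap := by
  classical
  have h : ⁅MvPolynomial.pderiv (R := ℂ) i, MvPolynomial.pderiv (R := ℂ) j⁆ = 0 := by
    apply MvPolynomial.derivation_ext
    intro k
    simp [Derivation.commutator_apply, MvPolynomial.pderiv_X, Pi.single_apply]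
    split_ifs <;> simp
  refine LinearMap.ext fun p => ?_
  have := DFunLike.congr_fun h p
  rw [Derivation.commutator_apply, Derivation.zero_apply, sub_eq_zero] at this
  exact this

open scoped IsMulCommutative in
/-- The action of `ℂ[∂₁, …, ∂ₙ]` on `ℂ[x₁, …, xₙ]` by differentiation: the `ℂ`-algebra
homomorphism into linear endomorphisms sending the variable `i` to `∂/∂xᵢ`, so `diffOp h f`
is `h ∘ f = h(∂/∂x₁, …, ∂/∂xₙ) f`. -/
noncomputable def diffOp (σ : Type*) :
    MvPolynomial σ ℂ →ₐ[ℂ] Module.End ℂ (MvPolynomial σ ℂ) :=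
  haveI : IsMulCommutative (Algebra.adjoin ℂ
      (Set.range fun i : σ => (MvPolynomial.pderiv (R := ℂ) i).toLinearMap)) :=
    Algebra.isMulCommutative_adjoin ℂ (by
      rintro _ ⟨i, rfl⟩ _ ⟨j, rfl⟩
      exact pderiv_toLinearMap_comm i j)
  (Algebra.adjoin ℂ
      (Set.range fun i : σ => (MvPolynomial.pderiv (R := ℂ) i).toLinearMap)).val.comp
    (MvPolynomial.aeval fun i => ⟨(MvPolynomial.pderiv (R := ℂ) i).toLinearMap,
      Algebra.subset_adjoin ⟨i, rfl⟩⟩)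

open scoped IsMulCommutative in
theorem diffOp_X {σ : Type*} (i : σ) (f : MvPolynomial σ ℂ) :
    diffOp σ (MvPolynomial.X i) f = MvPolynomial.pderiv i f := by
  simp [diffOp]

/-! ### Apolar algebras -/

/-- `Ann(f)`: the ideal of differential operators that annihilate `f`. -/
noncomputable def apolarAnn {σ : Type*} (f : MvPolynomial σ ℂ) : Ideal (MvPolynomial σ ℂ) where
  carrier := {h | diffOp σ h f = 0}
  zero_mem' := by simp
  add_mem' := by
    intro a b ha hb
    simp only [Set.mem_ofPred_eq] at ha hb ⊢
    simp [ha, hb]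
  smul_mem' := by
    intro c a ha
    simp only [Set.mem_ofPred_eq] at ha ⊢
    simp [ha]

/-- The apolar algebra `𝒜_f = ℂ[∂₁, …, ∂ₙ] / Ann(f)`. -/
abbrev ApolarAlgebra {σ : Type*} (f : MvPolynomial σ ℂ) : Type _ :=
  MvPolynomial σ ℂ ⧸ apolarAnn f

/-- Differentiation does not raise the total degree. -/
theorem diffOp_mem_restrictTotalDegree {σ : Type*} (d : ℕ) (h f : MvPolynomial σ ℂ)
    (hf : f ∈ MvPolynomial.restrictTotalDegree σ ℂ d) :
    diffOp σ h f ∈ MvPolynomial.restrictTotalDegree σ ℂ d := by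
  induction h using MvPolynomial.induction_on generalizing f with
  | C a =>
    have : diffOp σ (MvPolynomial.C a) = algebraMap ℂ _ a := (diffOp σ).commutes a
    rw [this, Module.algebraMap_end_apply]
    exact Submodule.smul_mem _ _ hf
  | add p q hp hq =>
    rw [map_add, LinearMap.add_apply]
    exact Submodule.add_mem _ (hp f hf) (hq f hf)
  | mul_X p i hp =>
    rw [map_mul, Module.End.mul_apply, diffOp_X]
    apply hp
    rw [MvPolynomial.mem_restrictTotalDegree] at hf ⊢
    refine Finset.sup_le fun m hm => ?_
    rw [MvPolynomial.mem_support_iff, MvPolynomial.coeff_pderiv] at hm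
    have hm' : m + Finsupp.single i 1 ∈ f.support :=
      MvPolynomial.mem_support_iff.mpr (left_ne_zero_of_mul hm)
    have h1 := (MvPolynomial.le_totalDegree hm').trans hf
    rw [Finsupp.sum_add_index' (fun _ => rfl) (fun _ _ _ => rfl)] at h1
    exact (Nat.le_add_right _ _).trans h1

/-- Apolar algebras are finite dimensional. -/
instance ApolarAlgebra.instFinite {σ : Type*} [Finite σ] (f : MvPolynomial σ ℂ) :
    Module.Finite ℂ (ApolarAlgebra f) := by
  let D := MvPolynomial.restrictTotalDegree σ ℂ f.totalDegree
  have hf : f ∈ D := (MvPolynomial.mem_restrictTotalDegree _ _ _).mpr le_rfl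
  let ψ : MvPolynomial σ ℂ →ₗ[ℂ] D :=
    { toFun := fun h => ⟨diffOp σ h f, diffOp_mem_restrictTotalDegree _ h f hf⟩
      map_add' := fun a b => by ext1; simp
      map_smul' := fun a b => by ext1; simp }
  have hker : (apolarAnn f).restrictScalars ℂ = LinearMap.ker ψ := by
    ext h
    rw [LinearMap.mem_ker, Submodule.restrictScalars_mem]
    exact (Subtype.ext_iff (a1 := ψ h) (a2 := 0)).symm
  have : Module.Finite ℂ (MvPolynomial σ ℂ ⧸ LinearMap.ker ψ) :=
    Module.Finite.equiv ψ.quotKerEquivRange.symm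
  have : Module.Finite ℂ (MvPolynomial σ ℂ ⧸ (apolarAnn f).restrictScalars ℂ) := by
    rw [hker]; infer_instance
  exact Module.Finite.equiv (Submodule.Quotient.restrictScalarsEquiv ℂ (apolarAnn f))

/-! ### Tensor rank and bilinear complexity -/

/-- The rank of a three-tensor: the least `r` such that it is a sum of `r` simple tensors. -/
noncomputable def tensorRank {U V W : Type*} [AddCommGroup U] [Module ℂ U] [AddCommGroup V]
    [Module ℂ V] [AddCommGroup W] [Module ℂ W] (T : U ⊗[ℂ] (V ⊗[ℂ] W)) : ℕ :=
  sInf {r : ℕ | ∃ (u : Fin r → U) (v : Fin r → V) (w : Fin r → W),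
    T = ∑ l, u l ⊗ₜ[ℂ] (v l ⊗ₜ[ℂ] w l)}

/-- The structure tensor `∑ i j, eᵢ ⊗ eⱼ ⊗ (eᵢ * eⱼ)` of an algebra with basis `e`. -/
noncomputable def structureTensor {A ι : Type*} [Ring A] [Algebra ℂ A] [Fintype ι]
    (e : Module.Basis ι ℂ A) : A ⊗[ℂ] (A ⊗[ℂ] A) :=
  ∑ i, ∑ j, e i ⊗ₜ[ℂ] (e j ⊗ₜ[ℂ] (e i * e j))

/-- `𝐑(A)`, the bilinear complexity (rank) of a finite-dimensional algebra: the tensor rank of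
its structure tensor. The basis used does not matter, see `algebraRank_eq`. -/
noncomputable def algebraRank (A : Type*) [Ring A] [Algebra ℂ A] [Module.Finite ℂ A] : ℕ :=
  tensorRank (structureTensor (Module.finBasis ℂ A))

/-- Every tensor is a finite sum of simple tensors. -/
theorem exists_tensorRank_decomp {U V W : Type*} [AddCommGroup U] [Module ℂ U] [AddCommGroup V]
    [Module ℂ V] [AddCommGroup W] [Module ℂ W] (T : U ⊗[ℂ] (V ⊗[ℂ] W)) :
    ∃ r : ℕ, ∃ (u : Fin r → U) (v : Fin r → V) (w : Fin r → W),
      T = ∑ l, u l ⊗ₜ[ℂ] (v l ⊗ₜ[ℂ] w l) := by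
  induction T using TensorProduct.induction_on with
  | zero => exact ⟨0, Fin.elim0, Fin.elim0, Fin.elim0, by simp⟩
  | tmul u s =>
    induction s using TensorProduct.induction_on with
    | zero => exact ⟨0, Fin.elim0, Fin.elim0, Fin.elim0, by simp⟩
    | tmul v w => exact ⟨1, fun _ => u, fun _ => v, fun _ => w, by simp⟩
    | add x y hx hy =>
      obtain ⟨r, a, b, c, h⟩ := hx
      obtain ⟨r', a', b', c', h'⟩ := hy
      exact ⟨r + r', Fin.append a a', Fin.append b b', Fin.append c c', by
        simp [Fin.sum_univ_add, TensorProduct.tmul_add, h, h']⟩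
  | add x y hx hy =>
    obtain ⟨r, a, b, c, h⟩ := hx
    obtain ⟨r', a', b', c', h'⟩ := hy
    exact ⟨r + r', Fin.append a a', Fin.append b b', Fin.append c c', by
      simp [Fin.sum_univ_add, h, h']⟩

theorem tensorRank_structureTensor_le {A ι κ : Type*} [Ring A] [Algebra ℂ A] [Fintype ι]
    [Fintype κ] (e : Module.Basis ι ℂ A) (e' : Module.Basis κ ℂ A) :
    tensorRank (structureTensor e') ≤ tensorRank (structureTensor e) := by
  obtain ⟨u, v, w, h⟩ : ∃ (u v w : Fin (tensorRank (structureTensor e)) → A),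
      structureTensor e = ∑ l, u l ⊗ₜ[ℂ] (v l ⊗ₜ[ℂ] w l) :=
    Nat.sInf_mem (exists_tensorRank_decomp (structureTensor e))
  let L : A →ₗ[ℂ] A := e.constr ℂ fun k => ∑ i, e.repr (e' i) k • e' i
  have key : structureTensor e' =
      TensorProduct.map L (TensorProduct.map L LinearMap.id) (structureTensor e) := by
    have hL : ∀ k, L (e k) = ∑ i, e.repr (e' i) k • e' i := fun k =>
      Module.Basis.constr_basis _ _ _ _
    have hm : ∀ i j, e' i * e' j =
        ∑ k, ∑ l, (e.repr (e' i) k * e.repr (e' j) l) • (e k * e l) := fun i j => by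
      conv_lhs => rw [← e.sum_repr (e' i), ← e.sum_repr (e' j), Finset.sum_mul_sum]
      simp [smul_smul, mul_comm]
    simp only [structureTensor, map_sum, TensorProduct.map_tmul, hL, LinearMap.id_apply, hm]
    let G (i j : κ) (k l : ι) : A ⊗[ℂ] (A ⊗[ℂ] A) :=
      (e.repr (e' i) k * e.repr (e' j) l) • (e' i ⊗ₜ[ℂ] (e' j ⊗ₜ[ℂ] (e k * e l)))
    calc
      _ = ∑ i, ∑ j, ∑ k, ∑ l, G i j k l := by
        simp only [TensorProduct.tmul_sum, TensorProduct.tmul_smul, G]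
      _ = ∑ i, ∑ k, ∑ j, ∑ l, G i j k l :=
        Finset.sum_congr rfl fun i _ => Finset.sum_comm
      _ = ∑ k, ∑ i, ∑ j, ∑ l, G i j k l := Finset.sum_comm
      _ = ∑ k, ∑ i, ∑ l, ∑ j, G i j k l :=
        Finset.sum_congr rfl fun k _ => Finset.sum_congr rfl fun i _ => Finset.sum_comm
      _ = ∑ k, ∑ l, ∑ i, ∑ j, G i j k l :=
        Finset.sum_congr rfl fun k _ => Finset.sum_comm
      _ = _ := by
        refine Finset.sum_congr rfl fun k _ => Finset.sum_congr rfl fun l _ => ?_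
        simp only [TensorProduct.sum_tmul, TensorProduct.tmul_sum, ← TensorProduct.smul_tmul',
          TensorProduct.tmul_smul, Finset.smul_sum, smul_smul, G]
        rw [Finset.sum_comm]
        simp only [mul_comm]
  refine Nat.sInf_le ⟨fun l => L (u l), fun l => L (v l), w, ?_⟩
  refine key.trans ((congrArg _ h).trans ?_)
  simp

/-- The bilinear complexity can be computed in any basis. -/
theorem algebraRank_eq {A ι : Type*} [Ring A] [Algebra ℂ A] [Module.Finite ℂ A] [Fintype ι]
    (e : Module.Basis ι ℂ A) : algebraRank A = tensorRank (structureTensor e) :=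
  le_antisymm (tensorRank_structureTensor_le _ _) (tensorRank_structureTensor_le _ _)

/-! ### Matrix multiplication and the determinant -/

/-- The exponent of matrix multiplication `ω = inf {c | 𝐑(Mₙ) ≤ O(n ^ c)}`. -/
noncomputable def matMulExponent : ℝ :=
  sInf {c : ℝ | (fun N : ℕ => (algebraRank (Matrix (Fin N) (Fin N) ℂ) : ℝ))
    =O[atTop] fun N : ℕ => (N : ℝ) ^ c}

/-- The determinant polynomial of degree `n` in the `n ^ 2` entries of a generic matrix. -/
noncomputable def detPoly (n : ℕ) : MvPolynomial (Fin n × Fin n) ℂ :=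
  (Matrix.mvPolynomialX (Fin n) (Fin n) ℂ).det

/-! Let Λ be the exterior algebra on 2n generators `e_1, …, e_n, f_1, …, f_n`. The multiplication of
the apolar algebra of `det_n` is a restriction of that of Λ, and Λ is a degeneration of the Clifford
algebra on 2n generators, which is the matrix algebra of size `2^n`. The degeneration costs only a
factor 4n+1.

Restriction: the elements `z_ij = e_i f_j` commute and satisfy `z_ij z_kl = -z_kj z_il`. Hence `G =
∏_j (1 + ∑_i x_ij z_ij)` obeys `∂_ij G = z_ij G`, and a suitably scaled top-coefficient functional
`t` sends `G` to `det_n`. So `h(∂) det_n = t(h(z) G)`, and every relation among the `z_ij` lies in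
`Ann(det_n)` (`aeval_eq_zero_imp_mem_apolarAnn_detPoly`). The apolar algebra is thus a quotient of
the subalgebra generated by the `z_ij`, which suffices for an upper bound (`HasBilinRank.quotient`).

Degeneration: Clifford monomials satisfy `W_S W_T = c W_{S ∆ T}`, and the product in Λ keeps exactly
the disjoint pairs. Since `|S| + |T| = |S ∆ T| + 2|S ∩ T|`, rescaling `W_S` by `ζ^|S|` and averaging
over roots of unity isolates the terms with `S ∩ T = ∅` (`hasBilinRank_disjointMul`). Pauli strings
provide the Clifford basis of the matrix algebra (`isCliffordBasis_pauliBasis`). -/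

/-! ### Bilinear rank -/

/-- The bilinear map `β` is a sum of `r` products of two linear forms and a vector. -/
def HasBilinRank {U V W : Type*} [AddCommGroup U] [Module ℂ U] [AddCommGroup V] [Module ℂ V]
    [AddCommGroup W] [Module ℂ W] (β : U →ₗ[ℂ] V →ₗ[ℂ] W) (r : ℕ) : Prop :=
  ∃ (f : Fin r → U →ₗ[ℂ] ℂ) (g : Fin r → V →ₗ[ℂ] ℂ) (w : Fin r → W),
    ∀ u v, β u v = ∑ l, (f l u * g l v) • w l

section BilinRank

variable {U V W : Type*} [AddCommGroup U] [Module ℂ U] [AddCommGroup V] [Module ℂ V]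
    [AddCommGroup W] [Module ℂ W]

theorem HasBilinRank.of_fintype {ι : Type*} [Fintype ι] {β : U →ₗ[ℂ] V →ₗ[ℂ] W}
    (f : ι → U →ₗ[ℂ] ℂ) (g : ι → V →ₗ[ℂ] ℂ) (w : ι → W)
    (h : ∀ u v, β u v = ∑ l, (f l u * g l v) • w l) : HasBilinRank β (Fintype.card ι) := by
  let e := (Fintype.equivFin ι).symm
  refine ⟨fun l => f (e l), fun l => g (e l), fun l => w (e l), fun u v => ?_⟩
  rw [h]
  exact (Equiv.sum_comp e fun l => (f l u * g l v) • w l).symm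

/-- A sum of `N` restrictions of a bilinear map of rank at most `r` has rank at most `N * r`. -/
theorem HasBilinRank.sum_restrict {U' V' W' : Type*} [AddCommGroup U'] [Module ℂ U']
    [AddCommGroup V'] [Module ℂ V'] [AddCommGroup W'] [Module ℂ W']
    {β : U →ₗ[ℂ] V →ₗ[ℂ] W} {r N : ℕ} (hβ : HasBilinRank β r) {γ : U' →ₗ[ℂ] V' →ₗ[ℂ] W'}
    (p : Fin N → W →ₗ[ℂ] W') (a : Fin N → U' →ₗ[ℂ] U) (b : Fin N → V' →ₗ[ℂ] V)
    (h : ∀ u v, γ u v = ∑ k, p k (β (a k u) (b k v))) : HasBilinRank γ (N * r) := by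
  obtain ⟨f, g, w, hfg⟩ := hβ
  have := HasBilinRank.of_fintype (β := γ) (ι := Fin N × Fin r)
    (fun x => f x.2 ∘ₗ a x.1) (fun x => g x.2 ∘ₗ b x.1) (fun x => p x.1 (w x.2)) (by
      intro u v
      rw [h, Fintype.sum_prod_type]
      refine Finset.sum_congr rfl fun k _ => ?_
      simp [hfg])
  simpa using this

theorem HasBilinRank.restrict {U' V' W' : Type*} [AddCommGroup U'] [Module ℂ U']
    [AddCommGroup V'] [Module ℂ V'] [AddCommGroup W'] [Module ℂ W']
    {β : U →ₗ[ℂ] V →ₗ[ℂ] W} {r : ℕ} (hβ : HasBilinRank β r) {γ : U' →ₗ[ℂ] V' →ₗ[ℂ] W'}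
    (p : W →ₗ[ℂ] W') (a : U' →ₗ[ℂ] U) (b : V' →ₗ[ℂ] V)
    (h : ∀ u v, γ u v = p (β (a u) (b v))) : HasBilinRank γ r := by
  have := hβ.sum_restrict (N := 1) (γ := γ) (fun _ => p) (fun _ => a) (fun _ => b) (by simpa using h)
  simpa using this

end BilinRank

/-! ### Tensor rank of the structure tensor versus rank of the multiplication map. -/

section AlgebraRank

variable {A : Type*} [Ring A] [Algebra ℂ A] [Module.Finite ℂ A]

theorem algebraRank_le_of_hasBilinRank {r : ℕ} (h : HasBilinRank (LinearMap.mul ℂ A) r) :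
    algebraRank A ≤ r := by
  obtain ⟨f, g, w, h⟩ := h
  let e := Module.finBasis ℂ A
  refine Nat.sInf_le ⟨fun l => ∑ i, f l (e i) • e i, fun l => ∑ j, g l (e j) • e j, w, ?_⟩
  have h' : ∀ i j, e i * e j = ∑ l, (f l (e i) * g l (e j)) • w l := fun i j => by
    rw [← h, LinearMap.mul_apply']
  have hl : ∀ l, (∑ i, f l (e i) • e i) ⊗ₜ[ℂ] ((∑ j, g l (e j) • e j) ⊗ₜ[ℂ] w l) =
      ∑ i, ∑ j, e i ⊗ₜ[ℂ] (e j ⊗ₜ[ℂ] ((f l (e i) * g l (e j)) • w l)) := fun l => by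
    simp only [TensorProduct.sum_tmul, TensorProduct.tmul_sum, ← TensorProduct.smul_tmul',
      TensorProduct.tmul_smul, smul_smul, Finset.smul_sum]
    rw [Finset.sum_comm]
    simp only [mul_comm]
  calc structureTensor e
      = ∑ i, ∑ j, ∑ l, e i ⊗ₜ[ℂ] (e j ⊗ₜ[ℂ] ((f l (e i) * g l (e j)) • w l)) := by
        simp only [structureTensor, h', TensorProduct.tmul_sum]
    _ = ∑ i, ∑ l, ∑ j, e i ⊗ₜ[ℂ] (e j ⊗ₜ[ℂ] ((f l (e i) * g l (e j)) • w l)) :=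
        Finset.sum_congr rfl fun i _ => Finset.sum_comm
    _ = ∑ l, ∑ i, ∑ j, e i ⊗ₜ[ℂ] (e j ⊗ₜ[ℂ] ((f l (e i) * g l (e j)) • w l)) := Finset.sum_comm
    _ = _ := Finset.sum_congr rfl fun l _ => (hl l).symm

/-- Contracting the first two factors of a decomposition of the structure tensor with dual basis
vectors recovers each product of basis vectors. -/
theorem hasBilinRank_algebraRank : HasBilinRank (LinearMap.mul ℂ A) (algebraRank A) := by
  let e := Module.finBasis ℂ A
  obtain ⟨u, v, w, h⟩ : ∃ (u v w : Fin (algebraRank A) → A),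
      structureTensor e = ∑ l, u l ⊗ₜ[ℂ] (v l ⊗ₜ[ℂ] w l) :=
    Nat.sInf_mem (exists_tensorRank_decomp (structureTensor e))
  refine ⟨fun l => e.constr ℂ fun i => e.repr (u l) i, fun l => e.constr ℂ fun i => e.repr (v l) i,
    w, ?_⟩
  have key : ∀ i j, e i * e j = ∑ l, (e.repr (u l) i * e.repr (v l) j) • w l := by
    intro i j
    have := congrArg ((TensorProduct.lid ℂ A).toLinearMap ∘ₗ TensorProduct.map (e.coord i)
      ((TensorProduct.lid ℂ A).toLinearMap ∘ₗ TensorProduct.map (e.coord j) LinearMap.id)) h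
    simp only [structureTensor, map_sum, LinearMap.comp_apply, TensorProduct.map_tmul,
      LinearEquiv.coe_coe, TensorProduct.lid_tmul, Module.Basis.coord_apply, LinearMap.id_apply,
      Module.Basis.repr_self, Finsupp.single_apply, ite_smul, one_smul, zero_smul,
      smul_smul] at this
    simpa using this
  intro x y
  have : LinearMap.mul ℂ A = ∑ l, (((LinearMap.mul ℂ ℂ).compl₁₂
      (e.constr ℂ fun i => e.repr (u l) i) (e.constr ℂ fun i => e.repr (v l) i)).compr₂
        (LinearMap.toSpanSingleton ℂ A (w l))) := by
    refine e.ext fun i => e.ext fun j => ?_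
    simp [key, LinearMap.sum_apply]
  rw [this]
  simp only [LinearMap.sum_apply, LinearMap.compr₂_apply, LinearMap.compl₁₂_apply,
    LinearMap.mul_apply', LinearMap.toSpanSingleton_apply]

theorem algebraRank_le_finrank_sq :
    algebraRank A ≤ Module.finrank ℂ A ^ 2 := by
  let e := Module.finBasis ℂ A
  have := HasBilinRank.of_fintype (β := LinearMap.mul ℂ A)
    (ι := Fin (Module.finrank ℂ A) × Fin (Module.finrank ℂ A))
    (fun x => e.coord x.1) (fun x => e.coord x.2) (fun x => e x.1 * e x.2) (by
      intro u v
      conv_lhs => rw [LinearMap.mul_apply', ← e.sum_repr u, ← e.sum_repr v, Finset.sum_mul_sum]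
      rw [Fintype.sum_prod_type]
      simp [smul_smul, mul_comm])
  refine (algebraRank_le_of_hasBilinRank this).trans ?_
  simp [sq]

end AlgebraRank

theorem hasBilinRank_mul_matrix_of_equiv {m n : Type*} [Fintype m] [DecidableEq m] [Fintype n]
    [DecidableEq n] (e : m ≃ n) :
    HasBilinRank (LinearMap.mul ℂ (Matrix m m ℂ)) (algebraRank (Matrix n n ℂ)) := by
  let φ := Matrix.reindexAlgEquiv ℂ ℂ e
  exact hasBilinRank_algebraRank.restrict φ.symm.toLinearMap φ.toLinearMap φ.toLinearMap
    (fun u v => by simp)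

/-! ### Exterior degeneration of a twisted group algebra -/

theorem Finset.card_add_card_eq_card_symmDiff {κ : Type*} [DecidableEq κ] (S T : Finset κ) :
    S.card + T.card = (symmDiff S T).card + 2 * (S ∩ T).card := by
  have h1 := Finset.card_sdiff_add_card_inter S T
  have h2 := Finset.card_sdiff_add_card_inter T S
  have h3 : (symmDiff S T).card = (S \ T).card + (T \ S).card :=
    Finset.card_union_of_disjoint disjoint_sdiff_sdiff
  rw [Finset.inter_comm T S] at h2
  omega

/-- A basis of an algebra, indexed by the subsets of `κ`, that multiplies like the monomials in
`|κ|` anticommuting invertible generators. -/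
structure IsCliffordBasis {M κ : Type*} [Ring M] [Algebra ℂ M] [DecidableEq κ]
    (W : Module.Basis (Finset κ) ℂ M) : Prop where
  empty : W ∅ = 1
  mul (S T : Finset κ) : ∃ c : ℂ, c ≠ 0 ∧ W S * W T = c • W (symmDiff S T)
  anticomm {i j : κ} (h : i ≠ j) : W {i} * W {j} = -(W {j} * W {i})

/-- The rescaling that multiplies `W S` by `c ^ |S|`. -/
noncomputable def basisScale {M κ : Type*} [Ring M] [Algebra ℂ M]
    (W : Module.Basis (Finset κ) ℂ M) (c : ℂ) : M →ₗ[ℂ] M :=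
  W.constr ℂ fun S => c ^ S.card • W S

theorem basisScale_basis {M κ : Type*} [Ring M] [Algebra ℂ M]
    (W : Module.Basis (Finset κ) ℂ M) (c : ℂ) (S : Finset κ) :
    basisScale W c (W S) = c ^ S.card • W S := by
  simp [basisScale, Module.Basis.constr_basis]

section Exterior

variable {M κ : Type*} [Ring M] [Algebra ℂ M] [DecidableEq κ]

/-- The bilinear product that agrees with the product of `M` on basis vectors indexed by disjoint
subsets and vanishes on all other pairs of basis vectors. -/
noncomputable def disjointMul (W : Module.Basis (Finset κ) ℂ M) : M →ₗ[ℂ] M →ₗ[ℂ] M :=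
  W.constr ℂ fun S => W.constr ℂ fun T => if Disjoint S T then W S * W T else 0

theorem disjointMul_basis (W : Module.Basis (Finset κ) ℂ M) (S T : Finset κ) :
    disjointMul W (W S) (W T) = if Disjoint S T then W S * W T else 0 := by
  simp [disjointMul, Module.Basis.constr_basis]

/-- Each summand collapses to `ζ ^ (m * k)`, so this is orthogonality of characters. The power `p`
is carried along because it arises from undoing the rescaling of a product. -/
theorem IsPrimitiveRoot.sum_pow_mul_inv_pow {N : ℕ} {ζ : ℂ} (hζ : IsPrimitiveRoot ζ N) (hN : N ≠ 0)
    {m p : ℕ} (hm : m < N) :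
    ∑ k : Fin N, ((ζ ^ (k : ℕ))⁻¹) ^ p * (ζ ^ (k : ℕ)) ^ (p + m) = if m = 0 then (N : ℂ) else 0 := by
  have h0 : ζ ≠ 0 := hζ.ne_zero hN
  have h1 : ∀ k : Fin N, ((ζ ^ (k : ℕ))⁻¹) ^ p * (ζ ^ (k : ℕ)) ^ (p + m) = (ζ ^ m) ^ (k : ℕ) := by
    intro k
    rw [pow_add, ← mul_assoc, ← mul_pow, inv_mul_cancel₀ (pow_ne_zero _ h0), one_pow, one_mul,
      ← pow_mul, ← pow_mul, mul_comm]
  rw [Finset.sum_congr rfl fun k _ => h1 k, Fin.sum_univ_eq_sum_range (fun k => (ζ ^ m) ^ k)]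
  split_ifs with h
  · simp [h]
  · have hne : ζ ^ m ≠ 1 := hζ.pow_ne_one_of_pos_of_lt h hm
    rw [geom_sum_eq hne, ← pow_mul, mul_comm, pow_mul, hζ.pow_eq_one]
    simp

namespace IsCliffordBasis

variable {W : Module.Basis (Finset κ) ℂ M}

theorem hasBilinRank_disjointMul [Fintype κ] (hW : IsCliffordBasis W) {r : ℕ}
    (hr : HasBilinRank (LinearMap.mul ℂ M) r) :
    HasBilinRank (disjointMul W) ((2 * Fintype.card κ + 1) * r) := by
  -- The unwanted exponents `2 * |S ∩ T|` are at most `2 * |κ|`; with `N` larger than that, only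
  -- exponent 0 is divisible by `N`.
  set N := 2 * Fintype.card κ + 1 with hN
  have hN0 : N ≠ 0 := by omega
  have hNC : (N : ℂ) ≠ 0 := by exact_mod_cast hN0
  obtain ⟨ζ, hζ⟩ : ∃ ζ : ℂ, IsPrimitiveRoot ζ N := ⟨_, Complex.isPrimitiveRoot_exp N hN0⟩
  let D : M →ₗ[ℂ] M →ₗ[ℂ] M := ∑ k : Fin N, ((LinearMap.mul ℂ M).compl₁₂
    (basisScale W (ζ ^ (k : ℕ))) (basisScale W (ζ ^ (k : ℕ)))).compr₂
      ((N : ℂ)⁻¹ • basisScale W (ζ ^ (k : ℕ))⁻¹)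
  have hD : disjointMul W = D := by
    refine W.ext fun S => W.ext fun T => ?_
    obtain ⟨c, -, hc⟩ := hW.mul S T
    have hcard := Finset.card_add_card_eq_card_symmDiff S T
    have hlt : 2 * (S ∩ T).card < N := by
      have := Finset.card_le_univ (S ∩ T)
      omega
    have hterm : ∀ k : Fin N, (N : ℂ)⁻¹ • basisScale W (ζ ^ (k : ℕ))⁻¹
        (basisScale W (ζ ^ (k : ℕ)) (W S) * basisScale W (ζ ^ (k : ℕ)) (W T)) =
        (((ζ ^ (k : ℕ))⁻¹) ^ (symmDiff S T).card *
          (ζ ^ (k : ℕ)) ^ ((symmDiff S T).card + 2 * (S ∩ T).card)) • ((N : ℂ)⁻¹ * c) •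
            W (symmDiff S T) := by
      intro k
      rw [basisScale_basis, basisScale_basis, smul_mul_smul_comm, hc, ← pow_add, hcard, map_smul,
        map_smul, basisScale_basis]
      simp only [smul_smul]
      congr 1
      ring
    simp only [D, LinearMap.sum_apply, LinearMap.compr₂_apply, LinearMap.compl₁₂_apply,
      LinearMap.mul_apply', LinearMap.smul_apply, hterm]
    rw [← Finset.sum_smul, hζ.sum_pow_mul_inv_pow hN0 hlt, disjointMul_basis]
    by_cases h : Disjoint S T
    · rw [if_pos h, if_pos (by simp [Finset.disjoint_iff_inter_eq_empty.mp h]), smul_smul,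
        mul_inv_cancel_left₀ hNC, hc]
    · rw [if_neg h, if_neg (by
        simpa [Finset.disjoint_iff_inter_eq_empty] using h), zero_smul]
  exact hr.sum_restrict (fun k => (N : ℂ)⁻¹ • basisScale W (ζ ^ (k : ℕ))⁻¹)
    (fun k => basisScale W (ζ ^ (k : ℕ))) (fun k => basisScale W (ζ ^ (k : ℕ)))
    (fun u v => by
      simp only [hD, D, LinearMap.sum_apply, LinearMap.compr₂_apply, LinearMap.compl₁₂_apply,
        LinearMap.mul_apply'])

/-- On basis vectors, both sides are the triple product in `M` if the three subsets are pairwise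
disjoint, and 0 otherwise. -/
theorem disjointMul_assoc (hW : IsCliffordBasis W) (x y z : M) :
    disjointMul W (disjointMul W x y) z = disjointMul W x (disjointMul W y z) := by
  set D := disjointMul W with hD
  have hST : ∀ S T, D (D (W S) (W T)) = D (W S) ∘ₗ D (W T) := by
    intro S T
    refine W.ext fun U => ?_
    obtain ⟨c, -, hc⟩ := hW.mul S T
    obtain ⟨d, -, hd⟩ := hW.mul T U
    rw [LinearMap.comp_apply, hD, disjointMul_basis W S T, disjointMul_basis W T U]
    by_cases h1 : Disjoint S T <;> by_cases h2 : Disjoint T U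
    · rw [if_pos h1, if_pos h2, hc, hd, map_smul, LinearMap.smul_apply, map_smul,
        disjointMul_basis, disjointMul_basis, h1.symmDiff_eq_sup, h2.symmDiff_eq_sup]
      simp only [Finset.sup_eq_union, Finset.disjoint_union_left, Finset.disjoint_union_right, h1,
        h2, true_and, and_true]
      split_ifs
      · rw [h1.symmDiff_eq_sup] at hc
        rw [h2.symmDiff_eq_sup] at hd
        rw [← Finset.sup_eq_union, ← Finset.sup_eq_union, ← smul_mul_assoc, ← mul_smul_comm, ← hc,
          ← hd, mul_assoc]
      · simp
    · rw [if_pos h1, if_neg h2, hc, map_smul, LinearMap.smul_apply, disjointMul_basis,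
        h1.symmDiff_eq_sup, Finset.sup_eq_union]
      simp [h2, Finset.disjoint_union_left]
    · rw [if_neg h1, if_pos h2, hd, map_smul, disjointMul_basis,
        h2.symmDiff_eq_sup, Finset.sup_eq_union]
      simp [h1, Finset.disjoint_union_right]
    · simp [h1, h2]
  -- Trilinear extension from basis vectors, one argument at a time.
  have hS : ∀ S, (D.flip z) ∘ₗ (D (W S)) = (D (W S)) ∘ₗ (D.flip z) := fun S =>
    W.ext fun T => DFunLike.congr_fun (hST S T) z
  have hx : (D.flip z) ∘ₗ (D.flip y) = D.flip (D y z) :=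
    W.ext fun S => DFunLike.congr_fun (hS S) y
  exact DFunLike.congr_fun hx x

theorem one_disjointMul (hW : IsCliffordBasis W) (x : M) : disjointMul W 1 x = x := by
  have : disjointMul W 1 = LinearMap.id := by
    refine W.ext fun S => ?_
    rw [← hW.empty, disjointMul_basis, if_pos (Finset.disjoint_empty_left _),
      hW.empty, one_mul, LinearMap.id_apply]
  exact DFunLike.congr_fun this x

theorem disjointMul_singleton_anticomm (hW : IsCliffordBasis W) (i j : κ) :
    disjointMul W (W {i}) (W {j}) = -disjointMul W (W {j}) (W {i}) := by
  rw [disjointMul_basis, disjointMul_basis]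
  by_cases h : i = j
  · simp [h]
  · simp [h, Ne.symm h, hW.anticomm h]

theorem exists_disjointMul_singleton (hW : IsCliffordBasis W) {i : κ} {S : Finset κ} (h : i ∉ S) :
    ∃ c : ℂ, c ≠ 0 ∧ disjointMul W (W {i}) (W S) = c • W (insert i S) := by
  obtain ⟨c, hc, h'⟩ := hW.mul {i} S
  have hd : Disjoint {i} S := Finset.disjoint_singleton_left.mpr h
  refine ⟨c, hc, ?_⟩
  rw [disjointMul_basis, if_pos hd, h', hd.symmDiff_eq_sup, Finset.sup_eq_union,
    Finset.singleton_union]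

theorem disjointMul_singleton_of_mem {i : κ} {S : Finset κ} (h : i ∈ S) :
    disjointMul W (W {i}) (W S) = 0 := by
  rw [disjointMul_basis, if_neg (by simpa using h)]

end IsCliffordBasis

end Exterior

/-! ### A Clifford basis of a matrix algebra -/

section PauliBasis

theorem Finset.prod_symmDiff_of_mul_self {κ R : Type*} [DecidableEq κ] [CommMonoid R] {f : κ → R}
    (hf : ∀ i, f i * f i = 1) (S T : Finset κ) :
    ∏ i ∈ symmDiff S T, f i = (∏ i ∈ S, f i) * ∏ i ∈ T, f i := by
  have h : symmDiff S T = (S \ T) ∪ (T \ S) := rfl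
  rw [h, Finset.prod_union disjoint_sdiff_sdiff, ← Finset.prod_inter_mul_prod_sdiff S T,
    ← Finset.prod_inter_mul_prod_sdiff T S, Finset.inter_comm T S, mul_mul_mul_comm,
    ← Finset.prod_mul_distrib (s := S ∩ T)]
  simp [hf]

theorem Finset.empty_symmDiff {κ : Type*} [DecidableEq κ] (S : Finset κ) : symmDiff ∅ S = S :=
  bot_symmDiff S

variable {n : ℕ}

/-- The Jordan–Wigner sign of the generator `s` at the site `j`. -/
def jwSign (s : Fin n ⊕ Fin n) (j : Fin n) : ℂ :=
  Sum.elim (fun i => if j < i then -1 else 1) (fun i => if j ≤ i then -1 else 1) s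

/-- The shift of the Pauli string indexed by `S`. -/
def pauliShift (S : Finset (Fin n ⊕ Fin n)) : Finset (Fin n) := symmDiff S.toLeft S.toRight

/-- The sign of the Pauli string indexed by `S`. -/
def pauliSign (S : Finset (Fin n ⊕ Fin n)) (q : Finset (Fin n)) : ℂ :=
  ∏ j ∈ q, ∏ s ∈ S, jwSign s j

/-- The Pauli string indexed by `S`, in the Jordan–Wigner representation. -/
def pauli (S : Finset (Fin n ⊕ Fin n)) : Matrix (Finset (Fin n)) (Finset (Fin n)) ℂ :=
  Matrix.of fun p q => if p = symmDiff (pauliShift S) q then pauliSign S q else 0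

theorem jwSign_mul_self (s : Fin n ⊕ Fin n) (j : Fin n) : jwSign s j * jwSign s j = 1 := by
  rcases s with i | i <;> simp only [jwSign, Sum.elim_inl, Sum.elim_inr] <;> split_ifs <;> norm_num

theorem pauliSign_symmDiff_right (S : Finset (Fin n ⊕ Fin n)) (p q : Finset (Fin n)) :
    pauliSign S (symmDiff p q) = pauliSign S p * pauliSign S q :=
  Finset.prod_symmDiff_of_mul_self (fun j => by
    rw [← Finset.prod_mul_distrib]; simp [jwSign_mul_self]) p q

theorem pauliSign_symmDiff_left (S T : Finset (Fin n ⊕ Fin n)) (q : Finset (Fin n)) :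
    pauliSign (symmDiff S T) q = pauliSign S q * pauliSign T q := by
  simp only [pauliSign, Finset.prod_symmDiff_of_mul_self (jwSign_mul_self · _),
    Finset.prod_mul_distrib]

theorem pauliSign_ne_zero (S : Finset (Fin n ⊕ Fin n)) (q : Finset (Fin n)) :
    pauliSign S q ≠ 0 :=
  Finset.prod_ne_zero_iff.mpr fun j _ => Finset.prod_ne_zero_iff.mpr fun s _ =>
    left_ne_zero_of_mul_eq_one (jwSign_mul_self s j)

theorem pauliShift_symmDiff (S T : Finset (Fin n ⊕ Fin n)) :
    pauliShift (symmDiff S T) = symmDiff (pauliShift S) (pauliShift T) := by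
  ext i
  simp only [pauliShift, Finset.mem_symmDiff, Finset.mem_toLeft, Finset.mem_toRight]
  tauto

/-- A Pauli string shifts by `pauliShift` after multiplying by a character of the group of subsets
under symmetric difference. Moving the character of `S` past the shift of `T` produces the scalar.
-/
theorem pauli_mul (S T : Finset (Fin n ⊕ Fin n)) :
    pauli S * pauli T = pauliSign S (pauliShift T) • pauli (symmDiff S T) := by
  ext p r
  rw [Matrix.mul_apply, Finset.sum_eq_single (symmDiff (pauliShift T) r)]
  · simp only [pauli, Matrix.of_apply, Matrix.smul_apply, if_true, pauliShift_symmDiff,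
      symmDiff_assoc, pauliSign_symmDiff_right, pauliSign_symmDiff_left, smul_eq_mul]
    split_ifs <;> ring
  · intro q _ hq
    simp [pauli, hq]
  · simp

theorem pauli_empty : pauli (∅ : Finset (Fin n ⊕ Fin n)) = 1 := by
  ext p q
  have h : pauliShift (∅ : Finset (Fin n ⊕ Fin n)) = ∅ := by
    ext; simp [pauliShift, Finset.mem_symmDiff]
  simp [pauli, h, pauliSign, Matrix.one_apply, Finset.empty_symmDiff]

/-- The two products differ only in the sign of `s` at the site of `t` versus that of `t` at the
site of `s`. The strict and weak inequalities in `jwSign` make exactly one of these -1, even when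
the sites coincide. -/
theorem pauli_singleton_anticomm {s t : Fin n ⊕ Fin n} (h : s ≠ t) :
    pauli {s} * pauli {t} = -(pauli {t} * pauli {s}) := by
  have h1 : ∀ t : Fin n ⊕ Fin n, pauliShift {t} = {Sum.elim id id t} := by
    rintro (i | i) <;> ext j <;>
      simp [pauliShift, Finset.mem_symmDiff, eq_comm]
  rw [pauli_mul, pauli_mul, h1, h1, symmDiff_comm, ← neg_smul]
  congr 1
  rcases s with i | i <;> rcases t with j | j <;>
    simp [pauliSign, jwSign] at h ⊢ <;>
    rcases lt_trichotomy i j with hl | hl | hl <;>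
    simp_all [not_lt_of_gt, le_of_lt, not_le_of_gt]

theorem trace_pauli_of_ne_empty {S : Finset (Fin n ⊕ Fin n)} (hS : S ≠ ∅) :
    (pauli S).trace = 0 := by
  simp only [Matrix.trace, Matrix.diag_apply, pauli, Matrix.of_apply]
  by_cases h : pauliShift S = ∅
  · have hLR : S.toLeft = S.toRight := symmDiff_eq_bot.mp h
    obtain ⟨i, hi⟩ : S.toLeft.Nonempty := by
      rw [Finset.nonempty_iff_ne_empty]
      intro h0
      apply hS
      rw [← Finset.toLeft_disjSum_toRight (u := S), ← hLR, h0]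
      rfl
    have hi' : i ∈ S.toRight := hLR ▸ hi
    -- The generators of `S` come in pairs `inl k`, `inr k`, whose joint sign at `i` is -1 exactly
    -- when `k = i`.
    have hsign : ∏ s ∈ S, jwSign s i = -1 := by
      rw [← Finset.toLeft_disjSum_toRight (u := S), Finset.prod_disjSum, ← hLR,
        ← Finset.prod_mul_distrib, Finset.prod_eq_single i]
      · simp [jwSign]
      · intro k _ hk
        rcases lt_or_gt_of_ne hk with h' | h' <;>
          simp [jwSign, h', not_lt_of_gt, le_of_lt, not_le_of_gt]
      · exact fun h' => absurd hi h'
    -- The sum over all subsets factors as a product over sites of 1 plus the sign at that site; the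
    -- factor at `i` vanishes.
    have hsum : ∑ q : Finset (Fin n), pauliSign S q = 0 := by
      have := Finset.prod_one_add (f := fun j => ∏ s ∈ S, jwSign s j) (Finset.univ : Finset (Fin n))
      rw [Finset.powerset_univ] at this
      simp only [pauliSign]
      rw [← this]
      exact Finset.prod_eq_zero (Finset.mem_univ i) (by rw [hsign]; norm_num)
    simpa [h, Finset.empty_symmDiff] using hsum
  · refine Finset.sum_eq_zero fun q _ => if_neg fun hq => h ?_
    have := congrArg (fun x => symmDiff x q) hq
    simpa [symmDiff_assoc] using this.symm

/-- Pauli strings are orthogonal for the trace form: pairing a relation with `pauli T` leaves only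
the coefficient of `T`, times a nonzero scalar. -/
theorem linearIndependent_pauli :
    LinearIndependent ℂ (pauli : Finset (Fin n ⊕ Fin n) → _) := by
  rw [Fintype.linearIndependent_iff]
  intro c hc T
  have h := congrArg (fun m => (m * pauli T).trace) hc
  simp only [Finset.sum_mul, Matrix.trace_sum, smul_mul_assoc, pauli_mul, Matrix.trace_smul,
    zero_mul, Matrix.trace_zero] at h
  rw [Finset.sum_eq_single T] at h
  · simpa [symmDiff_self, pauli_empty, pauliSign_ne_zero] using h
  · intro S _ hST
    rw [trace_pauli_of_ne_empty]
    · simp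
    · simpa using hST
  · simp

/-- The Pauli strings as a basis. -/
noncomputable def pauliBasis (n : ℕ) :
    Module.Basis (Finset (Fin n ⊕ Fin n)) ℂ (Matrix (Finset (Fin n)) (Finset (Fin n)) ℂ) :=
  basisOfLinearIndependentOfCardEqFinrank linearIndependent_pauli (by
    simp [Module.finrank_matrix, pow_add])

theorem isCliffordBasis_pauliBasis (n : ℕ) : IsCliffordBasis (pauliBasis n) where
  empty := by simp [pauliBasis, pauli_empty]
  mul S T := ⟨_, pauliSign_ne_zero S (pauliShift T), by simp [pauliBasis, pauli_mul]⟩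
  anticomm h := by simpa [pauliBasis] using pauli_singleton_anticomm h

end PauliBasis

/-! ### Algebras generated by the products of two families of anticommuting elements -/

theorem eq_zero_of_eq_neg_of_complex {V : Type*} [AddCommGroup V] [Module ℂ V] {x : V}
    (h : x = -x) : x = 0 := by
  have h2 : (2 : ℂ) • x = 0 := by rw [two_smul]; nth_rewrite 1 [h]; simp
  simpa using h2

theorem Derivation.map_prod_eq_zero {R A ι : Type*} [CommSemiring R] [CommSemiring A] [Algebra R A]
    (D : Derivation R A A) (s : Finset ι) (f : ι → A) (h : ∀ i ∈ s, D (f i) = 0) :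
    D (∏ i ∈ s, f i) = 0 := by
  classical
  induction s using Finset.induction_on with
  | empty => simp
  | insert a s ha ih =>
    rw [Finset.prod_insert ha, D.leibniz, h a (by simp), ih fun i hi => h i (by simp [hi])]
    simp

/-! ### Coefficientwise linear forms and differentiation. -/

section CoeffRel

variable {σ C : Type*} [CommRing C] [Algebra ℂ C]

/-- `q` is obtained from `p` by applying the linear form `t` to all coefficients. -/
def CoeffRel (t : C →ₗ[ℂ] ℂ) (p : MvPolynomial σ C) (q : MvPolynomial σ ℂ) : Prop :=
  ∀ m, q.coeff m = t (p.coeff m)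

variable {t : C →ₗ[ℂ] ℂ}

theorem CoeffRel.sum {ι : Type*} {s : Finset ι} {p : ι → MvPolynomial σ C}
    {q : ι → MvPolynomial σ ℂ} (h : ∀ i ∈ s, CoeffRel t (p i) (q i)) :
    CoeffRel t (∑ i ∈ s, p i) (∑ i ∈ s, q i) := fun m => by
  rw [MvPolynomial.coeff_sum, MvPolynomial.coeff_sum, map_sum]
  exact Finset.sum_congr rfl fun i hi => h i hi m

theorem CoeffRel.add {p p' : MvPolynomial σ C} {q q' : MvPolynomial σ ℂ} (h : CoeffRel t p q)
    (h' : CoeffRel t p' q') : CoeffRel t (p + p') (q + q') := fun m => by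
  simp [h m, h' m]

theorem CoeffRel.smul {p : MvPolynomial σ C} {q : MvPolynomial σ ℂ} (h : CoeffRel t p q) (a : ℂ) :
    CoeffRel t (a • p) (a • q) := fun m => by
  simp [h m]

/-- Differentiation multiplies coefficients by integers, which pass through the linear form `t`. -/
theorem CoeffRel.pderiv {p : MvPolynomial σ C} {q : MvPolynomial σ ℂ} (h : CoeffRel t p q)
    (i : σ) : CoeffRel t (MvPolynomial.pderiv i p) (MvPolynomial.pderiv i q) := fun m => by
  rw [MvPolynomial.coeff_pderiv, MvPolynomial.coeff_pderiv, h]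
  have : (((m i : C)) + 1) = algebraMap ℂ C ((m i : ℂ) + 1) := by simp
  rw [this, mul_comm _ (algebraMap ℂ C _), ← Algebra.smul_def, map_smul, smul_eq_mul, mul_comm]

theorem coeffRel_map_mul_C (p : MvPolynomial σ ℂ) (y : C) :
    CoeffRel t (MvPolynomial.map (algebraMap ℂ C) p * MvPolynomial.C y) (t y • p) := fun m => by
  rw [mul_comm, MvPolynomial.coeff_C_mul, MvPolynomial.coeff_map, mul_comm, ← Algebra.smul_def,
    map_smul, MvPolynomial.coeff_smul, smul_eq_mul, smul_eq_mul, mul_comm]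

/-- If `G` is multiplied by `z i` when differentiated by the variable `i`, then every relation
between the `z i` annihilates the polynomial of the `t`-coefficients of `G`. -/
theorem CoeffRel.diffOp_of_pderiv {z : σ → C} {G : MvPolynomial σ C} {f : MvPolynomial σ ℂ}
    (hG : ∀ i, MvPolynomial.pderiv i G = MvPolynomial.C (z i) * G) (hf : CoeffRel t G f)
    (h : MvPolynomial σ ℂ) :
    CoeffRel t (MvPolynomial.C (MvPolynomial.aeval z h) * G) (diffOp σ h f) := by
  induction h using MvPolynomial.induction_on with
  | C a =>
    have h1 : diffOp σ (MvPolynomial.C a) = algebraMap ℂ _ a := (diffOp σ).commutes a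
    have h2 : MvPolynomial.C (MvPolynomial.aeval z (MvPolynomial.C a)) * G = a • G := by
      rw [MvPolynomial.algHom_C, Algebra.smul_def]
      rfl
    rw [h1, Module.algebraMap_end_apply, h2]
    exact hf.smul a
  | add p q hp hq =>
    rw [map_add, map_add, map_add, add_mul, LinearMap.add_apply]
    exact hp.add hq
  | mul_X p i hp =>
    have h1 := hp.pderiv i
    rw [Derivation.leibniz, hG, MvPolynomial.pderiv_C, smul_zero, add_zero, smul_eq_mul,
      ← mul_assoc, ← map_mul] at h1
    rw [mul_comm p, map_mul (diffOp σ), Module.End.mul_apply, diffOp_X, mul_comm (MvPolynomial.X i),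
      map_mul (MvPolynomial.aeval z), MvPolynomial.aeval_X]
    exact h1

end CoeffRel

/-! ### The determinant as a functional of a generating function. -/

section DetRelation

theorem prod_comp_swap_eq_neg {n : ℕ} {C : Type*} [CommRing C] {z : Fin n × Fin n → C}
    (hz : ∀ i j k l, z (i, j) * z (k, l) = -(z (k, j) * z (i, l))) (g : Fin n → Fin n)
    {x y : Fin n} (hxy : x ≠ y) :
    ∏ j, z (g (Equiv.swap x y j), j) = -∏ j, z (g j, j) := by
  have hy : y ∈ Finset.univ.erase x := by simp [hxy.symm]
  rw [← Finset.mul_prod_erase _ _ (Finset.mem_univ x), ← Finset.mul_prod_erase _ _ hy,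
    ← Finset.mul_prod_erase _ (fun j => z (g j, j)) (Finset.mem_univ x),
    ← Finset.mul_prod_erase _ (fun j => z (g j, j)) hy, ← mul_assoc, ← mul_assoc,
    Equiv.swap_apply_left, Equiv.swap_apply_right, hz, neg_mul]
  congr 2
  refine Finset.prod_congr rfl fun j hj => ?_
  simp only [Finset.mem_erase, Finset.mem_univ, and_true] at hj
  rw [Equiv.swap_apply_of_ne_of_ne hj.2 hj.1]

theorem prod_perm_eq_sign_smul {n : ℕ} {C : Type*} [CommRing C] {z : Fin n × Fin n → C}
    (hz : ∀ i j k l, z (i, j) * z (k, l) = -(z (k, j) * z (i, l))) (τ : Equiv.Perm (Fin n)) :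
    ∏ j, z (τ j, j) = Equiv.Perm.sign τ • ∏ j, z (j, j) := by
  induction τ using Equiv.Perm.swap_induction_on' with
  | one => simp
  | mul_swap f x y hxy ih =>
    have := prod_comp_swap_eq_neg hz f hxy
    simp only [Equiv.Perm.mul_apply]
    rw [this, ih, Equiv.Perm.sign_mul, Equiv.Perm.sign_swap hxy]
    simp

variable {n : ℕ} {C : Type*} [CommRing C] [Algebra ℂ C] {z : Fin n × Fin n → C}

theorem prod_eq_zero_of_not_injective
    (hz : ∀ i j k l, z (i, j) * z (k, l) = -(z (k, j) * z (i, l))) {g : Fin n → Fin n}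
    (hg : ¬ Function.Injective g) : ∏ j, z (g j, j) = 0 := by
  simp only [Function.Injective, not_forall] at hg
  obtain ⟨x, y, hxy, hne⟩ := hg
  apply eq_zero_of_eq_neg_of_complex
  rw [← prod_comp_swap_eq_neg hz g hne]
  refine Finset.prod_congr rfl fun j _ => ?_
  by_cases h1 : j = x
  · subst h1; rw [Equiv.swap_apply_left, hxy]
  · by_cases h2 : j = y
    · subst h2; rw [Equiv.swap_apply_right, hxy]
    · rw [Equiv.swap_apply_of_ne_of_ne h1 h2]

/-- The generating function of the products of the `z (i, j)`. -/
noncomputable def detGenerating (z : Fin n × Fin n → C) : MvPolynomial (Fin n × Fin n) C :=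
  ∏ j, (1 + ∑ i, MvPolynomial.X (i, j) * MvPolynomial.C (z (i, j)))

theorem pderiv_detGenerating
    (hz : ∀ i j k l, z (i, j) * z (k, l) = -(z (k, j) * z (i, l))) (x : Fin n × Fin n) :
    MvPolynomial.pderiv x (detGenerating z) = MvPolynomial.C (z x) * detGenerating z := by
  obtain ⟨i, j⟩ := x
  have hd : ∀ l, MvPolynomial.pderiv (i, j)
      (1 + ∑ i, MvPolynomial.X (i, l) * MvPolynomial.C (z (i, l)) : MvPolynomial _ C) =
      if l = j then MvPolynomial.C (z (i, j)) else 0 := by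
    intro l
    simp only [map_add, map_sum, Derivation.leibniz, MvPolynomial.pderiv_C, MvPolynomial.pderiv_X,
      Derivation.map_one_eq_zero, zero_add, Pi.single_apply, smul_eq_mul, mul_ite,
      mul_one, mul_zero, Prod.mk.injEq]
    split_ifs with h
    · simp [h]
    · simp [h]
  -- With equal columns, the exchange relation makes the product its own negative.
  have hzz : ∀ k, z (i, j) * z (k, j) = 0 := fun k =>
    eq_zero_of_eq_neg_of_complex ((hz i j k j).trans (by rw [mul_comm]))
  have hmul : MvPolynomial.C (z (i, j)) *
      (1 + ∑ k, MvPolynomial.X (k, j) * MvPolynomial.C (z (k, j))) = MvPolynomial.C (z (i, j)) := by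
    rw [mul_add, mul_one, Finset.mul_sum, Finset.sum_eq_zero, add_zero]
    intro k _
    rw [mul_left_comm, ← map_mul, hzz, map_zero, mul_zero]
  rw [detGenerating, ← Finset.mul_prod_erase _ _ (Finset.mem_univ j), Derivation.leibniz,
    Derivation.map_prod_eq_zero, hd, if_pos rfl, smul_zero, zero_add, smul_eq_mul, ← mul_assoc,
    hmul, mul_comm]
  intro l hl
  rw [hd, if_neg (Finset.ne_of_mem_erase hl)]

/-- Expand the product over sets `U` of columns and choices `g` of a row in each. The form `t` kills
every `U` but the full one. There, repeated rows give 0 and permutations give their sign, which is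
the Leibniz formula. -/
theorem coeffRel_detGenerating
    (hz : ∀ i j k l, z (i, j) * z (k, l) = -(z (k, j) * z (i, l))) {t : C →ₗ[ℂ] ℂ}
    (ht : ∀ (U : Finset (Fin n)) (g : Fin n → Fin n), U ≠ Finset.univ → t (∏ j ∈ U, z (g j, j)) = 0)
    (ht' : t (∏ j, z (j, j)) = 1) : CoeffRel t (detGenerating z) (detPoly n) := by
  classical
  have hprod : ∀ (U : Finset (Fin n)) (g : Fin n → Fin n),
      CoeffRel t (∏ j ∈ U, (MvPolynomial.X (g j, j) * MvPolynomial.C (z (g j, j))))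
        (t (∏ j ∈ U, z (g j, j)) • ∏ j ∈ U, MvPolynomial.X (g j, j)) := by
    intro U g
    have := coeffRel_map_mul_C (t := t) (∏ j ∈ U, MvPolynomial.X (g j, j)) (∏ j ∈ U, z (g j, j))
    rwa [map_prod, map_prod, ← Finset.prod_mul_distrib,
      Finset.prod_congr rfl fun j _ => by rw [MvPolynomial.map_X]] at this
  have hdet : detPoly n = ∑ U : Finset (Fin n), if U = Finset.univ then detPoly n else 0 := by simp
  rw [detGenerating, Finset.prod_one_add, Finset.powerset_univ, hdet]
  refine CoeffRel.sum fun U _ => ?_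
  split_ifs with hU
  · subst hU
    rw [Finset.prod_univ_sum, Fintype.piFinset_univ]
    have : detPoly n = ∑ g : Fin n → Fin n,
        t (∏ j, z (g j, j)) • ∏ j, MvPolynomial.X (g j, j) := by
      rw [detPoly, Matrix.det_apply]
      refine Fintype.sum_of_injective (fun τ : Equiv.Perm (Fin n) => (τ : Fin n → Fin n))
        DFunLike.coe_injective _ _ ?_ ?_
      · intro g hg
        rw [prod_eq_zero_of_not_injective hz, map_zero, zero_smul]
        intro hinj
        exact hg ⟨Equiv.ofBijective g (Finite.injective_iff_bijective.mp hinj), rfl⟩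
      · intro τ
        rw [prod_perm_eq_sign_smul hz]
        rcases Int.units_eq_one_or (Equiv.Perm.sign τ) with h | h <;>
          simp [h, ht', Matrix.mvPolynomialX_apply]
    rw [this]
    exact CoeffRel.sum fun g _ => hprod _ g
  · rw [Finset.prod_sum]
    have h0 : (0 : MvPolynomial (Fin n × Fin n) ℂ) =
      ∑ g ∈ U.pi fun _ => (Finset.univ : Finset (Fin n)), 0 := by simp
    rw [h0]
    refine CoeffRel.sum fun g _ => ?_
    -- The choice of rows lives only on `U`; its value `j` off `U` is arbitrary and does not enter
    -- the product.
    have := hprod U fun j => if h : j ∈ U then g j h else j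
    rw [ht U _ hU, zero_smul, ← Finset.prod_attach] at this
    convert this using 3 <;> simp

theorem aeval_eq_zero_imp_mem_apolarAnn_detPoly
    (hz : ∀ i j k l, z (i, j) * z (k, l) = -(z (k, j) * z (i, l))) {t : C →ₗ[ℂ] ℂ}
    (ht : ∀ (U : Finset (Fin n)) (g : Fin n → Fin n), U ≠ Finset.univ → t (∏ j ∈ U, z (g j, j)) = 0)
    (ht' : t (∏ j, z (j, j)) = 1) {h : MvPolynomial (Fin n × Fin n) ℂ}
    (hh : MvPolynomial.aeval z h = 0) : h ∈ apolarAnn (detPoly n) := by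
  have := (coeffRel_detGenerating hz ht ht').diffOp_of_pderiv (pderiv_detGenerating hz) h
  change diffOp _ h (detPoly n) = 0
  ext m
  simpa [hh] using this m

end DetRelation

/-! ### The apolar algebra of the determinant -/

section ApolarDet

theorem exists_comp_eq_of_ker_le {K U V V' : Type*} [Field K] [AddCommGroup U] [Module K U]
    [AddCommGroup V] [Module K V] [AddCommGroup V'] [Module K V'] {f : U →ₗ[K] V} {g : U →ₗ[K] V'}
    (h : LinearMap.ker f ≤ LinearMap.ker g) : ∃ p : V →ₗ[K] V', p ∘ₗ f = g := by
  obtain ⟨q, hq⟩ := ((LinearMap.ker f).liftQ f le_rfl).exists_leftInverse_of_injective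
    (Submodule.ker_liftQ_eq_bot _ _ _ le_rfl)
  refine ⟨(LinearMap.ker f).liftQ g h ∘ₗ q, LinearMap.ext fun x => ?_⟩
  have : q (f x) = (LinearMap.ker f).mkQ x := DFunLike.congr_fun hq ((LinearMap.ker f).mkQ x)
  simp [this]

/-- If a linear map `E` with kernel inside an ideal `I` turns products into values of `β`, then the
multiplication modulo `I` is a restriction of `β`. -/
theorem HasBilinRank.quotient {R M : Type*} [CommRing R] [Algebra ℂ R] [AddCommGroup M]
    [Module ℂ M] {β : M →ₗ[ℂ] M →ₗ[ℂ] M} {r : ℕ} (hβ : HasBilinRank β r) (I : Ideal R)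
    (E : R →ₗ[ℂ] M) (hmul : ∀ x y, β (E x) (E y) = E (x * y)) (hker : ∀ x, E x = 0 → x ∈ I) :
    HasBilinRank (LinearMap.mul ℂ (R ⧸ I)) r := by
  obtain ⟨P, hP⟩ := exists_comp_eq_of_ker_le (f := E)
    (g := (Ideal.Quotient.mkₐ ℂ I).toLinearMap)
    (fun x hx => Ideal.Quotient.eq_zero_iff_mem.mpr (hker x hx))
  obtain ⟨s, hs⟩ := (Ideal.Quotient.mkₐ ℂ I).toLinearMap.exists_rightInverse_of_surjective
    (LinearMap.range_eq_top.mpr (Ideal.Quotient.mkₐ_surjective ℂ I))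
  have hs' : ∀ a, Ideal.Quotient.mkₐ ℂ I (s a) = a := fun a => DFunLike.congr_fun hs a
  refine hβ.restrict P (E ∘ₗ s) (E ∘ₗ s) fun a b => ?_
  rw [LinearMap.comp_apply, LinearMap.comp_apply, hmul, ← LinearMap.comp_apply P E, hP,
    AlgHom.toLinearMap_apply, map_mul, hs', hs', LinearMap.mul_apply']

variable {n : ℕ} {M : Type*} [Ring M] [Algebra ℂ M]
  {W : Module.Basis (Finset (Fin n ⊕ Fin n)) ℂ M}

/-- The operator of multiplication by the product of the `i`-th generator of the first kind and
the `j`-th generator of the second kind. -/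
noncomputable def pairOp (W : Module.Basis (Finset (Fin n ⊕ Fin n)) ℂ M) (x : Fin n × Fin n) :
    Module.End ℂ M :=
  disjointMul W (W {Sum.inl x.1}) * disjointMul W (W {Sum.inr x.2})

/-- Exchanging `a` and `c` across `b` takes three transpositions, hence the sign. -/
theorem mul_mul_mul_eq_neg_of_anticomm {R : Type*} [Ring R] {a b c d : R}
    (hbc : b * c = -(c * b)) (hac : a * c = -(c * a)) (hab : b * a = -(a * b)) :
    a * b * (c * d) = -(c * b * (a * d)) := by
  calc a * b * (c * d) = a * (b * c) * d := by noncomm_ring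
    _ = -(a * c * b * d) := by rw [hbc]; noncomm_ring
    _ = c * (a * b) * d := by rw [hac]; noncomm_ring
    _ = -(c * (b * a) * d) := by rw [hab]; noncomm_ring
    _ = _ := by noncomm_ring

theorem mul_mul_mul_comm_of_anticomm {R : Type*} [Ring R] {a b c d : R}
    (hac : a * c = -(c * a)) (had : a * d = -(d * a)) (hbc : b * c = -(c * b))
    (hbd : b * d = -(d * b)) : a * b * (c * d) = c * d * (a * b) := by
  calc a * b * (c * d) = a * (b * c) * d := by noncomm_ring
    _ = -(a * c * (b * d)) := by rw [hbc]; noncomm_ring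
    _ = -(c * (a * d) * b) := by rw [hac, hbd]; noncomm_ring
    _ = _ := by rw [had]; noncomm_ring

namespace IsCliffordBasis

theorem disjointMul_mul_anticomm (hW : IsCliffordBasis W) (s t : Fin n ⊕ Fin n) :
    (disjointMul W (W {s}) * disjointMul W (W {t}) : Module.End ℂ M) =
      -(disjointMul W (W {t}) * disjointMul W (W {s})) := by
  ext y
  rw [LinearMap.neg_apply, Module.End.mul_apply, Module.End.mul_apply, ← hW.disjointMul_assoc,
    ← hW.disjointMul_assoc, hW.disjointMul_singleton_anticomm, map_neg, LinearMap.neg_apply]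

theorem pairOp_comm (hW : IsCliffordBasis W) (x y : Fin n × Fin n) :
    pairOp W x * pairOp W y = pairOp W y * pairOp W x :=
  mul_mul_mul_comm_of_anticomm (hW.disjointMul_mul_anticomm _ _)
    (hW.disjointMul_mul_anticomm _ _) (hW.disjointMul_mul_anticomm _ _)
    (hW.disjointMul_mul_anticomm _ _)

theorem pairOp_mul_pairOp (hW : IsCliffordBasis W) (i j k l : Fin n) :
    pairOp W (i, j) * pairOp W (k, l) = -(pairOp W (k, j) * pairOp W (i, l)) :=
  mul_mul_mul_eq_neg_of_anticomm (hW.disjointMul_mul_anticomm _ _)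
    (hW.disjointMul_mul_anticomm _ _) (hW.disjointMul_mul_anticomm _ _)

theorem pairOp_disjointMul (hW : IsCliffordBasis W) (x : Fin n × Fin n) (y y' : M) :
    pairOp W x (disjointMul W y y') = disjointMul W (pairOp W x y) y' := by
  simp only [pairOp, Module.End.mul_apply, hW.disjointMul_assoc]

/-- Allowing `c = 0` when `inl i` already occurs lets products with repeated rows be handled
uniformly. -/
theorem exists_pairOp_basis (hW : IsCliffordBasis W) (i j : Fin n)
    (S : Finset (Fin n ⊕ Fin n)) (hj : Sum.inr j ∉ S) :
    ∃ c : ℂ, (Sum.inl i ∉ S → c ≠ 0) ∧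
      pairOp W (i, j) (W S) = c • W (insert (Sum.inl i) (insert (Sum.inr j) S)) := by
  obtain ⟨c, hc, h⟩ := hW.exists_disjointMul_singleton hj
  by_cases hi : Sum.inl i ∈ S
  · refine ⟨0, fun h' => absurd hi h', ?_⟩
    rw [pairOp, Module.End.mul_apply, h, map_smul, disjointMul_singleton_of_mem (by simp [hi])]
    simp
  · obtain ⟨d, hd, h'⟩ := hW.exists_disjointMul_singleton
      (show Sum.inl i ∉ insert (Sum.inr j) S by simp [hi])
    exact ⟨c * d, fun _ => mul_ne_zero hc hd, by
      rw [pairOp, Module.End.mul_apply, h, map_smul, h', smul_smul]⟩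

section CommRepresentation

variable {C : Type*} [CommRing C] [Algebra ℂ C] {ρ : C →ₐ[ℂ] Module.End ℂ M}
  {z : Fin n × Fin n → C}

/-- The generators of the second kind record the columns used, so a product over a proper subset of
columns never reaches the top basis vector. -/
theorem exists_prod_apply_one (hW : IsCliffordBasis W) (hz : ∀ x, ρ (z x) = pairOp W x)
    (U : Finset (Fin n)) (g : Fin n → Fin n) : ∃ (c : ℂ) (S : Finset (Fin n ⊕ Fin n)),
      ρ (∏ j ∈ U, z (g j, j)) 1 = c • W S ∧ ∀ j, Sum.inr j ∈ S ↔ j ∈ U := by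
  induction U using Finset.induction_on with
  | empty => exact ⟨1, ∅, by simp [hW.empty], by simp⟩
  | insert a U ha ih =>
    obtain ⟨c, S, h, hS⟩ := ih
    obtain ⟨d, -, hd⟩ := hW.exists_pairOp_basis (g a) a S (by rwa [hS])
    refine ⟨c * d, insert (Sum.inl (g a)) (insert (Sum.inr a) S), ?_, ?_⟩
    · rw [Finset.prod_insert ha, map_mul, Module.End.mul_apply, h, map_smul, hz, hd, smul_smul]
    · simp [hS]

theorem exists_prod_diag_apply_one (hW : IsCliffordBasis W) (hz : ∀ x, ρ (z x) = pairOp W x)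
    (U : Finset (Fin n)) :
    ∃ c : ℂ, c ≠ 0 ∧ ρ (∏ j ∈ U, z (j, j)) 1 = c • W (U.disjSum U) := by
  induction U using Finset.induction_on with
  | empty => exact ⟨1, one_ne_zero, by simp [hW.empty]⟩
  | insert a U ha ih =>
    obtain ⟨c, hc, h⟩ := ih
    obtain ⟨d, hd0, hd⟩ := hW.exists_pairOp_basis a a (U.disjSum U) (by simpa using ha)
    refine ⟨c * d, mul_ne_zero hc (hd0 (by simpa using ha)), ?_⟩
    have hset : (insert a U).disjSum (insert a U) =
        insert (Sum.inl a) (insert (Sum.inr a) (U.disjSum U)) := by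
      ext (i | i) <;> simp
    rw [Finset.prod_insert ha, map_mul, Module.End.mul_apply, h, map_smul, hset, hz, hd, smul_smul]

theorem aeval_disjointMul (hW : IsCliffordBasis W) (hz : ∀ x, ρ (z x) = pairOp W x)
    (h : MvPolynomial (Fin n × Fin n) ℂ) (y y' : M) :
    ρ (MvPolynomial.aeval z h) (disjointMul W y y') =
      disjointMul W (ρ (MvPolynomial.aeval z h) y) y' := by
  induction h using MvPolynomial.induction_on generalizing y y' with
  | C a => simp
  | add p q hp hq => simp [hp, hq]
  | mul_X p x hp =>
    rw [map_mul, map_mul, Module.End.mul_apply, Module.End.mul_apply, MvPolynomial.aeval_X, hz,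
      hW.pairOp_disjointMul, hp]

theorem mem_apolarAnn_detPoly (hW : IsCliffordBasis W) (hz : ∀ x, ρ (z x) = pairOp W x)
    (hρ : Function.Injective ρ) {h : MvPolynomial (Fin n × Fin n) ℂ}
    (hh : ρ (MvPolynomial.aeval z h) 1 = 0) : h ∈ apolarAnn (detPoly n) := by
  obtain ⟨c, hc, hcW⟩ := hW.exists_prod_diag_apply_one hz Finset.univ
  -- The top coefficient of the action on 1, scaled by `c⁻¹` so that the diagonal product has value
  -- 1.
  let t : C →ₗ[ℂ] ℂ := c⁻¹ • (W.coord Finset.univ ∘ₗ LinearMap.applyₗ (1 : M) ∘ₗ ρ.toLinearMap)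
  have hval : ∀ y, t y = c⁻¹ * W.repr (ρ y 1) Finset.univ := fun _ => rfl
  refine aeval_eq_zero_imp_mem_apolarAnn_detPoly (z := z) (t := t) (fun i j k l => hρ ?_)
    (fun U g hU => ?_) ?_ (hρ (LinearMap.ext fun y => ?_))
  · simp only [map_mul, map_neg, hz, hW.pairOp_mul_pairOp i j k l]
  · obtain ⟨d, S, h, hS⟩ := hW.exists_prod_apply_one hz U g
    have hSU : S ≠ Finset.univ := by
      rintro rfl
      exact hU (Finset.eq_univ_of_forall fun j => (hS j).mp (Finset.mem_univ _))
    rw [hval, h]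
    simp [hSU]
  · rw [hval, hcW, Finset.univ_disjSum_univ]
    simp [hc]
  -- The operator commutes with right multiplications, so it is determined by its value at 1.
  · rw [← hW.one_disjointMul y, hW.aeval_disjointMul hz, hh]
    simp

theorem hasBilinRank_apolarAlgebra_detPoly_of_representation (hW : IsCliffordBasis W)
    (hz : ∀ x, ρ (z x) = pairOp W x) (hρ : Function.Injective ρ) {r : ℕ}
    (hr : HasBilinRank (disjointMul W) r) :
    HasBilinRank (LinearMap.mul ℂ (ApolarAlgebra (detPoly n))) r := by
  refine hr.quotient (apolarAnn (detPoly n))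
    (LinearMap.applyₗ (1 : M) ∘ₗ ρ.toLinearMap ∘ₗ (MvPolynomial.aeval z).toLinearMap)
    (fun h h' => ?_) fun h hh => hW.mem_apolarAnn_detPoly hz hρ hh
  change disjointMul W (ρ (MvPolynomial.aeval z h) 1) (ρ (MvPolynomial.aeval z h') 1) =
    ρ (MvPolynomial.aeval z (h * h')) 1
  rw [← hW.aeval_disjointMul hz, hW.one_disjointMul, map_mul, map_mul, Module.End.mul_apply]

end CommRepresentation

open scoped IsMulCommutative in
/-- The multiplication of the apolar algebra of the determinant is a restriction of the
multiplication of the exterior algebra. -/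
theorem hasBilinRank_apolarAlgebra_detPoly (hW : IsCliffordBasis W) {r : ℕ}
    (hr : HasBilinRank (disjointMul W) r) :
    HasBilinRank (LinearMap.mul ℂ (ApolarAlgebra (detPoly n))) r := by
  have : IsMulCommutative (Algebra.adjoin ℂ (Set.range (pairOp W))) :=
    Algebra.isMulCommutative_adjoin ℂ (by
      rintro _ ⟨x, rfl⟩ _ ⟨y, rfl⟩
      exact hW.pairOp_comm x y)
  exact hasBilinRank_apolarAlgebra_detPoly_of_representation
    (C := Algebra.adjoin ℂ (Set.range (pairOp W)))
    (ρ := (Algebra.adjoin ℂ (Set.range (pairOp W))).val)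
    (z := fun x => ⟨pairOp W x, Algebra.subset_adjoin ⟨x, rfl⟩⟩) hW (fun _ => rfl)
    Subtype.val_injective hr

end IsCliffordBasis

end ApolarDet

/-! ### The rank of the apolar algebra of the determinant -/

theorem algebraRank_apolarAlgebra_detPoly_le (n : ℕ) :
    algebraRank (ApolarAlgebra (detPoly n)) ≤
      (4 * n + 1) * algebraRank (Matrix (Fin (2 ^ n)) (Fin (2 ^ n)) ℂ) := by
  have e : Finset (Fin n) ≃ Fin (2 ^ n) := Fintype.equivFinOfCardEq (by simp)
  have hW := isCliffordBasis_pauliBasis n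
  have h := algebraRank_le_of_hasBilinRank (hW.hasBilinRank_apolarAlgebra_detPoly
    (hW.hasBilinRank_disjointMul (hasBilinRank_mul_matrix_of_equiv e)))
  have hcard : 2 * Fintype.card (Fin n ⊕ Fin n) + 1 = 4 * n + 1 := by simp; ring
  rwa [hcard] at h

theorem isBigO_algebraRank_apolarAlgebra_detPoly :
    (fun n : ℕ => (algebraRank (ApolarAlgebra (detPoly n)) : ℝ))
      =O[atTop] fun n : ℕ =>
        (n : ℝ) * (algebraRank (Matrix (Fin (2 ^ n)) (Fin (2 ^ n)) ℂ) : ℝ) := by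
  -- For `n ≥ 1`, `4n + 1 ≤ 5n`.
  refine IsBigO.of_bound 5 (eventually_atTop.mpr ⟨1, fun n hn => ?_⟩)
  rw [Real.norm_of_nonneg (by positivity), Real.norm_of_nonneg (by positivity)]
  calc (algebraRank (ApolarAlgebra (detPoly n)) : ℝ)
      ≤ (4 * n + 1) * algebraRank (Matrix (Fin (2 ^ n)) (Fin (2 ^ n)) ℂ) := by
        exact_mod_cast algebraRank_apolarAlgebra_detPoly_le n
    _ ≤ (5 * n) * algebraRank (Matrix (Fin (2 ^ n)) (Fin (2 ^ n)) ℂ) := by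
        have : (1 : ℝ) ≤ n := by exact_mod_cast hn
        gcongr
        linarith
    _ = _ := by ring

theorem isBigO_algebraRank_apolarAlgebra_detPoly_of_matrix {c : ℝ}
    (hc : (fun N : ℕ => (algebraRank (Matrix (Fin N) (Fin N) ℂ) : ℝ))
      =O[atTop] fun N : ℕ => (N : ℝ) ^ c) :
    (fun n : ℕ => (algebraRank (ApolarAlgebra (detPoly n)) : ℝ))
      =O[atTop] fun n : ℕ => (n : ℝ) * (2 : ℝ) ^ (c * (n : ℝ)) := by
  -- Specialize the matrix bound to sizes `N = 2 ^ n`.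
  have h := hc.comp_tendsto (tendsto_pow_atTop_atTop_of_one_lt (one_lt_two (α := ℕ)))
  refine isBigO_algebraRank_apolarAlgebra_detPoly.trans ((isBigO_refl _ _).mul (h.congr_right ?_))
  intro n
  rw [Function.comp_apply, Nat.cast_pow, Nat.cast_ofNat, ← Real.rpow_natCast_mul zero_le_two,
    mul_comm]

/-- Shows that the set of admissible exponents is nonempty, so that some admissible exponent lies
below `matMulExponent + ε`. -/
theorem isBigO_algebraRank_matrix_rpow_four :
    (fun N : ℕ => (algebraRank (Matrix (Fin N) (Fin N) ℂ) : ℝ))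
      =O[atTop] fun N : ℕ => (N : ℝ) ^ (4 : ℝ) := by
  refine IsBigO.of_bound 1 (Eventually.of_forall fun N => ?_)
  rw [Real.norm_of_nonneg (by positivity), Real.norm_of_nonneg (by positivity), one_mul]
  have h := algebraRank_le_finrank_sq (A := Matrix (Fin N) (Fin N) ℂ)
  rw [Module.finrank_matrix, Module.finrank_self, Fintype.card_fin, mul_one] at h
  have h4 : ((N : ℝ) ^ (4 : ℝ)) = ((N * N) ^ 2 : ℕ) := by
    rw [show (4 : ℝ) = ((4 : ℕ) : ℝ) by norm_num, Real.rpow_natCast]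
    push_cast
    ring
  rw [h4]
  exact_mod_cast h

theorem mainTheorem5 :
    (∀ ε : ℝ, 0 < ε →
      (fun n : ℕ => (algebraRank (ApolarAlgebra (detPoly n)) : ℝ))
        =O[atTop] fun n : ℕ => (n : ℝ) * (2 : ℝ) ^ ((matMulExponent + ε) * (n : ℝ))) ∧
    ((fun N : ℕ => (algebraRank (Matrix (Fin N) (Fin N) ℂ) : ℝ))
        =O[atTop] (fun N : ℕ => (N : ℝ) ^ matMulExponent) →
      (fun n : ℕ => (algebraRank (ApolarAlgebra (detPoly n)) : ℝ))
        =O[atTop] fun n : ℕ => (n : ℝ) * (2 : ℝ) ^ (matMulExponent * (n : ℝ))) ∧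
    (fun n : ℕ => (algebraRank (ApolarAlgebra (detPoly n)) : ℝ))
      =O[atTop] fun n : ℕ =>
        (n : ℝ) * (algebraRank (Matrix (Fin (2 ^ n)) (Fin (2 ^ n)) ℂ) : ℝ) := by
  refine ⟨fun ε hε => ?_, isBigO_algebraRank_apolarAlgebra_detPoly_of_matrix,
    isBigO_algebraRank_apolarAlgebra_detPoly⟩
  obtain ⟨c, hc, hlt⟩ := exists_lt_of_csInf_lt ⟨4, isBigO_algebraRank_matrix_rpow_four⟩
    (lt_add_of_pos_right matMulExponent hε)
  refine (isBigO_algebraRank_apolarAlgebra_detPoly_of_matrix hc).trans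
    (IsBigO.of_bound 1 (Eventually.of_forall fun n => ?_))
  rw [Real.norm_of_nonneg (by positivity), Real.norm_of_nonneg (by positivity), one_mul]
  gcongr
  exact one_le_two
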